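/- **Setting.** Let $A,B:\mathbb R^n\rightrightarrows\mathbb R^n$ be maximal monotone operators such that $0\in A(x)+B(x)$ has at least one solution. Let $\mathcal B:\mathbb R^n\times\mathbb R^n\times(0,\infty)\times\mathbb R^n\times\mathbb R^n\times\{1,2,\dots\}\to\mathbb R^n\times\mathbb R^n$ be a $\mathcal B$-procedure, that is: for all $r,b,\bar s,\bar b\in\mathbb R^n$ and $\gamma>0$, the points $(s^\ell,b^\ell)=\mathcal B(r,b,\gamma,\bar s,\bar b,\ell)$, $\ell\ge 1$, satisfy $b^\ell\in B(s^\ell)$ for all $\ell$, the sequence $\{(s^\ell,b^\ell)\}$ converges, and $s^\ell+\gamma b^\ell\to r+\gamma b$. **Algorithm.** Choose $\gamma>0$, $0\le\alpha,\sigma<1$ and $0<\underline\rho<\overline\rho<2$, and $(s^0,b^0,r^0)=(s^{-1},b^{-1},r^{-1})\in(\mathbb R^n)^3$. For $k=0,1,2,\dots$: choose $\alpha_k\in[0,\alpha]$ and set $$(\hat s^k,\hat b^k,\hat r^k)=(s^k,b^k,r^k)+\alpha_k\big[(s^k,b^k,r^k)-(s^{k-1},b^{k-1},r^{k-1})\big].$$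 Inner loop: for $\ell=1,2,\dots$ compute $(s^{k,\ell},b^{k,\ell})=\mathcal B(\hat r^k,\hat b^k,\gamma,\hat s^k,\hat b^k,\ell)$ and the pair $(r^{k,\ell},a^{k,\ell})$ with $a^{k,\ell}\in A(r^{k,\ell})$ and $r^{k,\ell}+\gamma a^{k,\ell}=s^{k,\ell}-\gamma b^{k,\ell}$, until $$\|s^{k,\ell}+\gamma b^{k,\ell}-(\hat r^k+\gamma\hat b^k)\|^2\le\sigma^2\big(\|r^{k,\ell}+\gamma b^{k,\ell}-(\hat r^k+\gamma\hat b^k)\|^2+\|s^{k,\ell}-r^{k,\ell}\|^2\big).$$ Let $\ell(k)$ be the first $\ell$ for which this holds, if there is one. With $\ell=\ell(k)$: if $s^{k,\ell}=r^{k,\ell}$, stop. Otherwise choose $\rho_k\in[\underline\rho,\overline\rho]$ and set $s^{k+1}=s^{k,\ell}$, $r^{k+1}=r^{k,\ell}$, $$\theta_{k+1}=\frac{\langle(\hat r^k-r^{k,\ell})+\gamma(\hat b^k-b^{k,\ell}),\,s^{k,\ell}-r^{k,\ell}\rangle}{\|s^{k,\ell}-r^{k,\ell}\|^2},$$ $$b^{k+1}=\hat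 b^k-\gamma^{-1}\big[(1-\rho_k\theta_{k+1})r^{k+1}+\rho_k\theta_{k+1}s^{k+1}-\hat r^k\big].$$ **Theorem.** Consider any execution of this algorithm such that, for some $\beta>0$, one has $\alpha<\beta<1$, $$\overline\rho=\frac{2(\beta-1)^2}{2(\beta-1)^2+3\beta-1},$$ and the sequence $\{\alpha_k\}$, over the outer iterations $k$ that are started, is nondecreasing. (a) If there are infinitely many outer iterations, each inner loop terminating after finitely many iterations $\ell(k)$, then there are a solution $x^*$ of $0\in A(x)+B(x)$ and a $b^*\in B(x^*)$ with $-b^*\in A(x^*)$ such that $s^k\to x^*$, $r^k\to x^*$, $b^{k,\ell(k)}\to b^*$, $b^k\to b^*$ and $a^{k,\ell(k)}\to-b^*$ as $k\to\infty$. (b) Let $\sigma>0$. If there are only finitely many outer iterations, the last one being $k=\bar k$, and the inner loop of iteration $\bar k$ never terminates, then there are a solution $x^*$ of $0\in A(x)+B(x)$ and a $b^*\in B(x^*)$ with $-b^*\in A(x^*)$ such that $s^{\bar k,\ell}\to x^*$, $r^{\bar k,\ell}\to x^*$, $b^{\bar k,\ell}\to b^*$ and $a^{\bar k,\ell}\to-b^*$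 as $\ell\to\infty$. (c) If the algorithm stops with $s^{k,\ell}=r^{k,\ell}$, then $z^*:=s^{k,\ell}=r^{k,\ell}$ is a solution of $0\in A(x)+B(x)$. -/

import Mathlib

open Filter Topology
open scoped Pointwise

namespace InertialDR

/-- The space `ℝⁿ` with its Euclidean norm and inner product. -/
abbrev Vec (n : ℕ) : Type := EuclideanSpace ℝ (Fin n)

/-- A set-valued operator on `ℝⁿ`. -/
abbrev Operator (n : ℕ) : Type := Vec n → Set (Vec n)

/-- `⟪x - y, u - v⟫ ≥ 0` whenever `u ∈ T x` and `v ∈ T y`. -/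
def IsMonotone {n : ℕ} (T : Operator n) : Prop :=
  ∀ x y : Vec n, ∀ u ∈ T x, ∀ v ∈ T y, 0 ≤ inner ℝ (x - y) (u - v)

/-- Maximality is with respect to pointwise inclusion, i.e. inclusion of graphs. -/
def IsMaximalMonotone {n : ℕ} (T : Operator n) : Prop :=
  Maximal IsMonotone T

/-- `x` solves the inclusion `0 ∈ A x + B x` (Minkowski sum of the two sets). -/
def IsSolution {n : ℕ} (A B : Operator n) (x : Vec n) : Prop :=
  (0 : Vec n) ∈ A x + B x

/-- The type of a procedure `(r, b, γ, s̄, b̄, ℓ) ↦ (s^ℓ, b^ℓ)`.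
Only the values at `γ > 0` and `ℓ ≥ 1` are ever used. -/
abbrev Procedure (n : ℕ) : Type :=
  Vec n → Vec n → ℝ → Vec n → Vec n → ℕ → Vec n × Vec n

/-- `P` is a `B`-procedure for the problems `0 ∈ s + γ B(s) - (r + γ b)`: for all data, the trial
points `(s^ℓ, b^ℓ)`, `ℓ ≥ 1`, lie in the graph of `B`, converge, and satisfy
`s^ℓ + γ b^ℓ → r + γ b`. -/
def IsBProcedure {n : ℕ} (B : Operator n) (P : Procedure n) : Prop :=
  ∀ (r b : Vec n) (γ : ℝ) (sbar bbar : Vec n), 0 < γ →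
    (∀ ℓ : ℕ, 1 ≤ ℓ → (P r b γ sbar bbar ℓ).2 ∈ B (P r b γ sbar bbar ℓ).1) ∧
    (∃ q : Vec n × Vec n, Tendsto (fun ℓ => P r b γ sbar bbar ℓ) atTop (𝓝 q)) ∧
    Tendsto (fun ℓ => (P r b γ sbar bbar ℓ).1 + γ • (P r b γ sbar bbar ℓ).2) atTop
      (𝓝 (r + γ • b))

/-- The scalar parameters chosen at the start of the algorithm. -/
structure Params where
  γ : ℝ
  α : ℝ
  σ : ℝ
  ρmin : ℝ
  ρmax : ℝ
  γ_pos : 0 < γ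
  α_nonneg : 0 ≤ α
  α_lt_one : α < 1
  σ_nonneg : 0 ≤ σ
  σ_lt_one : σ < 1
  ρmin_pos : 0 < ρmin
  ρmin_lt_ρmax : ρmin < ρmax
  ρmax_lt_two : ρmax < 2

/-- The values of all variables of the algorithm. For an execution that ends or gets stuck, only
the entries that are actually computed are constrained, the other ones are irrelevant.
* `s k`, `b k`, `r k` are the outer iterates, `α k`, `ρ k` the parameters of outer iteration `k`,
  and `θ k` the step factor (computed for `k ≥ 1`);
* `sIn k ℓ`, `bIn k ℓ`, `rIn k ℓ`, `aIn k ℓ` are the inner iterates, for `ℓ ≥ 1`;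
* `last k` is the value of `ℓ` at which the inner loop of outer iteration `k` terminates. -/
structure Trace (n : ℕ) where
  s : ℕ → Vec n
  b : ℕ → Vec n
  r : ℕ → Vec n
  α : ℕ → ℝ
  ρ : ℕ → ℝ
  θ : ℕ → ℝ
  sIn : ℕ → ℕ → Vec n
  bIn : ℕ → ℕ → Vec n
  rIn : ℕ → ℕ → Vec n
  aIn : ℕ → ℕ → Vec n
  last : ℕ → ℕ

/-- The extrapolated point `x^k + α_k (x^k - x^{k-1})`. At `k = 0` the natural-number subtraction
`0 - 1 = 0` implements the initialization `x^{-1} = x^0`. -/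
def extrapolate {n : ℕ} (α : ℕ → ℝ) (x : ℕ → Vec n) (k : ℕ) : Vec n :=
  x k + α k • (x k - x (k - 1))

namespace Trace

variable {n : ℕ} (t : Trace n)

def sHat (k : ℕ) : Vec n := extrapolate t.α t.s k

def bHat (k : ℕ) : Vec n := extrapolate t.α t.b k

def rHat (k : ℕ) : Vec n := extrapolate t.α t.r k

/-- The computations of inner iteration `ℓ` of outer iteration `k`: one step of the
`B`-procedure `P`, and an exact evaluation of the resolvent of `A`. -/
def InnerStep (A : Operator n) (P : Procedure n) (p : Params) (k ℓ : ℕ) : Prop :=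
  (t.sIn k ℓ, t.bIn k ℓ) = P (t.rHat k) (t.bHat k) p.γ (t.sHat k) (t.bHat k) ℓ ∧
  t.aIn k ℓ ∈ A (t.rIn k ℓ) ∧
  t.rIn k ℓ + p.γ • t.aIn k ℓ = t.sIn k ℓ - p.γ • t.bIn k ℓ

/-- The relative-error criterion which terminates the inner loop. -/
def Accepted (p : Params) (k ℓ : ℕ) : Prop :=
  ‖t.sIn k ℓ + p.γ • t.bIn k ℓ - (t.rHat k + p.γ • t.bHat k)‖ ^ 2 ≤
    p.σ ^ 2 * (‖t.rIn k ℓ + p.γ • t.bIn k ℓ - (t.rHat k + p.γ • t.bHat k)‖ ^ 2 +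
      ‖t.sIn k ℓ - t.rIn k ℓ‖ ^ 2)

/-- The inner loop of outer iteration `k` terminates, and `t.last k ≥ 1` is the first index at
which the criterion holds. -/
def InnerLoopTerminates (A : Operator n) (P : Procedure n) (p : Params) (k : ℕ) : Prop :=
  1 ≤ t.last k ∧
  (∀ ℓ : ℕ, 1 ≤ ℓ → ℓ ≤ t.last k → t.InnerStep A P p k ℓ) ∧
  (∀ ℓ : ℕ, 1 ≤ ℓ → ℓ < t.last k → ¬ t.Accepted p k ℓ) ∧
  t.Accepted p k (t.last k)

/-- The inner loop of outer iteration `k` runs forever. -/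
def InnerLoopRunsForever (A : Operator n) (P : Procedure n) (p : Params) (k : ℕ) : Prop :=
  ∀ ℓ : ℕ, 1 ≤ ℓ → t.InnerStep A P p k ℓ ∧ ¬ t.Accepted p k ℓ

/-- The update at the end of outer iteration `k`. -/
def Update (p : Params) (k : ℕ) : Prop :=
  t.ρ k ∈ Set.Icc p.ρmin p.ρmax ∧
  t.s (k + 1) = t.sIn k (t.last k) ∧
  t.r (k + 1) = t.rIn k (t.last k) ∧
  t.θ (k + 1) =
    inner ℝ ((t.rHat k - t.rIn k (t.last k)) + p.γ • (t.bHat k - t.bIn k (t.last k)))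
      (t.sIn k (t.last k) - t.rIn k (t.last k)) /
        ‖t.sIn k (t.last k) - t.rIn k (t.last k)‖ ^ 2 ∧
  t.b (k + 1) = t.bHat k - p.γ⁻¹ •
    ((1 - t.ρ k * t.θ (k + 1)) • t.r (k + 1) + (t.ρ k * t.θ (k + 1)) • t.s (k + 1) - t.rHat k)

/-- Outer iteration `k` is carried out completely, without stopping. -/
def Completes (A : Operator n) (P : Procedure n) (p : Params) (k : ℕ) : Prop :=
  t.α k ∈ Set.Icc 0 p.α ∧
  t.InnerLoopTerminates A P p k ∧
  t.sIn k (t.last k) ≠ t.rIn k (t.last k) ∧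
  t.Update p k

/-- An execution with infinitely many outer iterations. -/
def IsInfiniteRun (A : Operator n) (P : Procedure n) (p : Params) : Prop :=
  ∀ k : ℕ, t.Completes A P p k

/-- An execution whose last outer iteration is number `K`, in which the inner loop runs forever. -/
def IsRunStuckAt (A : Operator n) (P : Procedure n) (p : Params) (K : ℕ) : Prop :=
  (∀ k : ℕ, k < K → t.Completes A P p k) ∧
  t.α K ∈ Set.Icc 0 p.α ∧
  t.InnerLoopRunsForever A P p K

/-- An execution which stops in outer iteration `K`, because of `s^{K,ℓ} = r^{K,ℓ}` at the end of
the inner loop. -/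
def IsRunStoppedAt (A : Operator n) (P : Procedure n) (p : Params) (K : ℕ) : Prop :=
  (∀ k : ℕ, k < K → t.Completes A P p k) ∧
  t.α K ∈ Set.Icc 0 p.α ∧
  t.InnerLoopTerminates A P p K ∧
  t.sIn K (t.last K) = t.rIn K (t.last K)

end Trace

end InertialDR

/-! The argument follows the single sequence `z k = r k + γ b k`. Call a point `x + γ w` with `w ∈ B
x` and `-w ∈ A x` a zero. With `v` and `p` denoting `s - r` and `r + γ b` at the accepted inner
iterate, monotonicity of `A` and `B` places every zero `c` in the half-space `⟪v, p - c⟫ ≥ 0`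
(`splitting_inner_nonneg`). The update of `b` makes `z (k + 1)` a relaxed projection of the
extrapolated point onto this half-space (`Completes.gov_succ`). The error criterion makes `θ`
nonnegative and bounds both residuals by the length of that step.

The result is a Fejér inequality with inertia. The formula for `ρmax` is exactly what lets the gain
from projecting dominate the loss from extrapolating while `α < β`; hence the squared steps are
summable and the distance to each zero converges (`inertial_fejer`). The residuals then vanish, a
cluster point of `z` is a zero because resolvents are continuous and graphs are closed, and
convergence of the distance to that zero gives convergence of all of `z`.

In (b), failure of the criterion with `σ > 0` bounds `s - r` by an error tending to zero. In (c), `s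
= r` forces `a = -b`. -/

namespace InertialDR

/-! ### Scalar recursions with inertia. -/

section RealSequences

/-- A sequence bounded below whose increments contract up to a summable error converges. -/
theorem exists_tendsto_of_inertial_le {φ a δ : ℕ → ℝ} {α : ℝ} (hφ : ∀ k, 0 ≤ φ k)
    (ha : ∀ k, 0 ≤ a k) (haα : ∀ k, a k ≤ α) (hα : α < 1) (hδ : ∀ k, 0 ≤ δ k)
    (hsum : Summable δ)
    (h : ∀ k, φ (k + 1) - φ k ≤ a k * (φ k - φ (k - 1)) + δ k) :
    ∃ l, Tendsto φ atTop (𝓝 l) := by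
  set u : ℕ → ℝ := fun k => max (φ k - φ (k - 1)) 0 with hu
  have hu0 : ∀ k, 0 ≤ u k := fun k => le_max_right _ _
  have hα0 : 0 ≤ α := (ha 0).trans (haα 0)
  have hstep : ∀ k, u (k + 1) ≤ α * u k + δ k := by
    intro k
    have h1 : a k * (φ k - φ (k - 1)) ≤ α * u k :=
      (mul_le_mul_of_nonneg_left (le_max_left _ _) (ha k)).trans
        (mul_le_mul_of_nonneg_right (haα k) (hu0 k))
    refine max_le ?_ (add_nonneg (mul_nonneg hα0 (hu0 k)) (hδ k))
    have := h k
    simp only [Nat.add_sub_cancel]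
    linarith
  have hbound : ∀ n, ∑ i ∈ Finset.range n, u i ≤ (∑' i, δ i) / (1 - α) := by
    intro n
    rw [le_div_iff₀ (by linarith)]
    have h1 : ∑ i ∈ Finset.range (n + 1), u i ≤
        α * ∑ i ∈ Finset.range n, u i + ∑ i ∈ Finset.range n, δ i := by
      rw [Finset.sum_range_succ', Finset.mul_sum, ← Finset.sum_add_distrib]
      -- The truncated subtraction `0 - 1 = 0` makes the initial increment vanish.
      have : u 0 = 0 := by simp [hu]
      rw [this, add_zero]
      exact Finset.sum_le_sum fun i _ => hstep i
    have h2 : ∑ i ∈ Finset.range n, u i ≤ ∑ i ∈ Finset.range (n + 1), u i := by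
      rw [Finset.sum_range_succ]
      linarith [hu0 n]
    have h3 := hsum.sum_le_tsum (Finset.range n) fun i _ => hδ i
    linarith
  have husum : Summable u := summable_of_sum_range_le hu0 hbound
  have hW := husum.hasSum.tendsto_sum_nat.comp (tendsto_add_atTop_nat 1)
  -- Subtracting the accumulated positive increments leaves only the decreases of `φ`.
  set w : ℕ → ℝ := fun n => φ n - ∑ i ∈ Finset.range (n + 1), u i with hw
  have hanti : Antitone w := by
    refine antitone_nat_of_succ_le fun n => ?_
    have : φ (n + 1) - φ n ≤ u (n + 1) := le_max_left _ _
    simp only [hw]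
    rw [Finset.sum_range_succ _ (n + 1)]
    linarith
  have hbdd : BddBelow (Set.range w) := by
    refine ⟨-((∑' i, δ i) / (1 - α)), ?_⟩
    rintro _ ⟨n, rfl⟩
    have := hbound (n + 1)
    have := hφ n
    simp only [hw]
    linarith
  refine ⟨_, ((tendsto_atTop_ciInf hanti hbdd).add hW).congr fun n => ?_⟩
  simp [hw]

/-- A Lyapunov argument for inertial methods: the squared steps `d` are summable. -/
theorem summable_of_inertial_le {φ d a : ℕ → ℝ} {α μ ε : ℝ} (hφ : ∀ k, 0 ≤ φ k)
    (hd : ∀ k, 0 ≤ d k) (hd0 : d 0 = 0) (ha : ∀ k, 0 ≤ a k) (haα : ∀ k, a k ≤ α) (hα : α < 1)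
    (hmono : ∀ k, a k ≤ a (k + 1)) (hμ : 0 ≤ μ) (hε : 0 < ε)
    (hgap : ∀ k, ε ≤ μ * (1 - a k) ^ 2 - a k * (1 + a k))
    (h : ∀ k, φ (k + 1) - φ k ≤ a k * (φ k - φ (k - 1)) +
      (a k * (1 + a k) + μ * (a k * (1 - a k))) * d k - μ * (1 - a k) * d (k + 1)) :
    Summable d := by
  set g : ℕ → ℝ := fun k => a k * (1 + a k) + μ * (a k * (1 - a k)) with hg
  -- The Lyapunov function. It may be negative, so its decrease alone does not bound `φ`.
  set L : ℕ → ℝ := fun k => φ k - a k * φ (k - 1) + g k * d k with hL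
  have hα0 : 0 ≤ α := (ha 0).trans (haα 0)
  have hg0 : ∀ k, 0 ≤ g k := fun k => by
    have h1 := ha k
    have h2 : 0 ≤ 1 - a k := by linarith [haα k]
    simp only [hg]
    positivity
  have hdec : ∀ k, L (k + 1) + ε * d (k + 1) ≤ L k := by
    intro k
    have h1 := h k
    have h2 : a k * φ k ≤ a (k + 1) * φ k := mul_le_mul_of_nonneg_right (hmono k) (hφ k)
    -- By monotonicity `a k` may be replaced by `a (k + 1)`; then `μ(1 - a) - μa(1 - a) = μ(1 - a)²`
    -- reduces the claim to `hgap`.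
    have h3 : ε + g (k + 1) ≤ μ * (1 - a k) := by
      have := hgap (k + 1)
      have := mul_le_mul_of_nonneg_left (hmono k) hμ
      simp only [hg]
      nlinarith
    have h4 := mul_le_mul_of_nonneg_right h3 (hd (k + 1))
    simp only [hL, Nat.add_sub_cancel]
    simp only [hg] at h4 ⊢
    linarith
  have hsum : ∀ n, L n + ε * ∑ i ∈ Finset.range (n + 1), d i ≤ φ 0 := by
    intro n
    induction n with
    | zero =>
      have := mul_nonneg (ha 0) (hφ 0)
      simp only [hL, Nat.zero_sub, hd0, zero_add, Finset.sum_range_one]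
      linarith
    | succ n ih =>
      rw [Finset.sum_range_succ]
      linarith [hdec n]
  have hL' : ∀ n, φ n - α * φ (n - 1) ≤ L n := fun n => by
    have h1 := mul_le_mul_of_nonneg_right (haα n) (hφ (n - 1))
    have h2 := mul_nonneg (hg0 n) (hd n)
    simp only [hL]
    linarith
  have hS : ∀ n, 0 ≤ ∑ i ∈ Finset.range n, d i := fun n => Finset.sum_nonneg fun i _ => hd i
  -- The fixed point of `c ↦ α c + φ 0`, which bounds `φ` by induction.
  set C := φ 0 / (1 - α) with hC
  have hC' : C = α * C + φ 0 := by
    have : (1 - α) ≠ 0 := by linarith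
    rw [hC]
    field_simp
    ring
  have hC0 : φ 0 ≤ C := by
    rw [hC, le_div_iff₀ (by linarith)]
    nlinarith [hφ 0]
  have hφC : ∀ n, φ n ≤ C := by
    intro n
    induction n with
    | zero => exact hC0
    | succ n ih =>
      have h1 := hsum (n + 1)
      have h2 := hL' (n + 1)
      have h3 := mul_nonneg hε.le (hS (n + 1 + 1))
      have h4 := mul_le_mul_of_nonneg_left ih hα0
      simp only [Nat.add_sub_cancel] at h2
      linarith
  refine summable_of_sum_range_le (c := C / ε) hd fun n => ?_
  rw [le_div_iff₀ hε]
  have h1 := hsum n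
  have h2 := hL' n
  have h3 := mul_le_mul_of_nonneg_left (hφC (n - 1)) hα0
  have h4 := hφ n
  have h5 := mul_nonneg hε.le (hd n)
  rw [Finset.sum_range_succ] at h1
  linarith

end RealSequences

/-! ### Inertial Fejér sequences and relaxed projections. -/

section Inertia

variable {E : Type*} [NormedAddCommGroup E] [InnerProductSpace ℝ E]

theorem norm_extrapolation_sub_sq (x y c : E) (a : ℝ) :
    ‖x + a • (x - y) - c‖ ^ 2 =
      (1 + a) * ‖x - c‖ ^ 2 - a * ‖y - c‖ ^ 2 + a * (1 + a) * ‖x - y‖ ^ 2 := by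
  have h1 : x + a • (x - y) - c = (1 + a) • (x - c) - a • (y - c) := by module
  have h2 : x - y = (x - c) - (y - c) := by abel
  rw [h1, h2, norm_sub_sq_real (x - c), norm_sub_sq_real (_ • (x - c)), norm_smul, norm_smul, mul_pow, mul_pow,
    real_inner_smul_left, real_inner_smul_right, Real.norm_eq_abs, Real.norm_eq_abs, sq_abs, sq_abs]
  ring

/-- The cross term is controlled by `2⟪w - x, x - y⟫ ≤ ‖w - x‖² + ‖x - y‖²`. This turns the step
from the extrapolated point into two ordinary steps. -/
theorem le_norm_sub_extrapolation_sq (x y w : E) {a : ℝ} (ha : 0 ≤ a) :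
    (1 - a) * ‖w - x‖ ^ 2 - a * (1 - a) * ‖x - y‖ ^ 2 ≤ ‖w - (x + a • (x - y))‖ ^ 2 := by
  have h1 : w - (x + a • (x - y)) = (w - x) - a • (x - y) := by module
  have h2 := sq_nonneg ‖(w - x) - (x - y)‖
  rw [norm_sub_sq_real] at h2
  rw [h1, norm_sub_sq_real (w - x), norm_smul, mul_pow, real_inner_smul_right, Real.norm_eq_abs,
    sq_abs]
  nlinarith [mul_nonneg ha h2]

/-- An inertial sequence satisfying a Fejér-type inequality with respect to `c` has square-summable
steps, and its distance to `c` converges. -/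
theorem inertial_fejer {z : ℕ → E} {c : E} {a : ℕ → ℝ} {α μ ε : ℝ}
    (ha : ∀ k, 0 ≤ a k) (haα : ∀ k, a k ≤ α) (hα : α < 1)
    (hmono : ∀ k, a k ≤ a (k + 1)) (hμ : 0 ≤ μ) (hε : 0 < ε)
    (hgap : ∀ k, ε ≤ μ * (1 - a k) ^ 2 - a k * (1 + a k))
    (h : ∀ k, ‖z (k + 1) - c‖ ^ 2 ≤ ‖z k + a k • (z k - z (k - 1)) - c‖ ^ 2 -
      μ * ‖z (k + 1) - (z k + a k • (z k - z (k - 1)))‖ ^ 2) :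
    Summable (fun k => ‖z k - z (k - 1)‖ ^ 2) ∧
      ∃ l, Tendsto (fun k => ‖z k - c‖ ^ 2) atTop (𝓝 l) := by
  have ha1 : ∀ k, 0 ≤ 1 - a k := fun k => by linarith [haα k]
  have hkey : ∀ k, ‖z (k + 1) - c‖ ^ 2 - ‖z k - c‖ ^ 2 ≤
      a k * (‖z k - c‖ ^ 2 - ‖z (k - 1) - c‖ ^ 2) +
      (a k * (1 + a k) + μ * (a k * (1 - a k))) * ‖z k - z (k - 1)‖ ^ 2 -
        μ * (1 - a k) * ‖z (k + 1) - z (k + 1 - 1)‖ ^ 2 := by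
    intro k
    have h1 := h k
    rw [norm_extrapolation_sub_sq] at h1
    have h2 := mul_le_mul_of_nonneg_left
      (le_norm_sub_extrapolation_sq (z k) (z (k - 1)) (z (k + 1)) (ha k)) hμ
    simp only [Nat.add_sub_cancel]
    linarith
  have hsum : Summable (fun k => ‖z k - z (k - 1)‖ ^ 2) :=
    summable_of_inertial_le (φ := fun k => ‖z k - c‖ ^ 2) (d := fun k => ‖z k - z (k - 1)‖ ^ 2)
      (fun k => sq_nonneg _) (fun k => sq_nonneg _) (by simp) ha haα hα hmono hμ hε hgap hkey
  refine ⟨hsum, exists_tendsto_of_inertial_le (φ := fun k => ‖z k - c‖ ^ 2)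
    (δ := fun k => (2 + μ) * ‖z k - z (k - 1)‖ ^ 2)
    (fun k => sq_nonneg _) ha haα hα (fun k => by positivity) (hsum.mul_left _) fun k => ?_⟩
  have h1 := hkey k
  have h2 : 0 ≤ μ * (1 - a k) * ‖z (k + 1) - z (k + 1 - 1)‖ ^ 2 :=
    mul_nonneg (mul_nonneg hμ (ha1 k)) (sq_nonneg _)
  have h3 : a k * (1 + a k) + μ * (a k * (1 - a k)) ≤ 2 + μ := by
    have := ha k
    have := ha1 k
    have h5 : a k * (1 - a k) ≤ 1 := by nlinarith
    nlinarith [mul_le_mul_of_nonneg_left h5 hμ]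
  have h4 := mul_le_mul_of_nonneg_right h3 (sq_nonneg ‖z k - z (k - 1)‖)
  linarith

/-- A relaxed projection onto a half-space containing `c`. -/
theorem norm_relaxed_projection_sub_sq_le {y p v c : E} {ρ ρ' θ : ℝ} (hρ : 0 < ρ) (hρρ' : ρ ≤ ρ')
    (hv : v ≠ 0) (hθ : θ = inner ℝ (y - p) v / ‖v‖ ^ 2) (hθ0 : 0 ≤ θ)
    (hc : 0 ≤ inner ℝ v (p - c)) :
    ‖y - (ρ * θ) • v - c‖ ^ 2 ≤
      ‖y - c‖ ^ 2 - (2 / ρ' - 1) * ‖y - (ρ * θ) • v - y‖ ^ 2 := by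
  have hv2 : ‖v‖ ^ 2 ≠ 0 := by simpa using hv
  have hin : inner ℝ (y - p) v = θ * ‖v‖ ^ 2 := by
    rw [hθ]
    field_simp
  have h1 : y - (ρ * θ) • v - c = (y - c) - (ρ * θ) • v := by abel
  have h2 : y - (ρ * θ) • v - y = -((ρ * θ) • v) := by abel
  have h3 : inner ℝ (y - c) v = θ * ‖v‖ ^ 2 + inner ℝ v (p - c) := by
    rw [← hin, real_inner_comm (p - c) v, ← inner_add_left]
    congr 1
    abel
  rw [h1, h2, norm_neg, norm_sub_sq_real, norm_smul, mul_pow, real_inner_smul_right,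
    Real.norm_eq_abs, sq_abs, h3]
  have h4 : 0 ≤ ρ * θ * inner ℝ v (p - c) := by positivity
  -- The case `ρ = ρ'` is an equality; a smaller `ρ` only helps.
  have h5 : 2 / ρ' * ((ρ * θ) ^ 2 * ‖v‖ ^ 2) ≤ 2 * ρ * (θ ^ 2 * ‖v‖ ^ 2) := by
    have : 2 / ρ' * ρ ≤ 2 := by
      rw [div_mul_eq_mul_div, div_le_iff₀ (hρ.trans_le hρρ')]
      linarith
    calc 2 / ρ' * ((ρ * θ) ^ 2 * ‖v‖ ^ 2) = (2 / ρ' * ρ) * (ρ * (θ ^ 2 * ‖v‖ ^ 2)) := by ring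
      _ ≤ 2 * (ρ * (θ ^ 2 * ‖v‖ ^ 2)) := mul_le_mul_of_nonneg_right this (by positivity)
      _ = _ := by ring
  nlinarith

/-- Expanding `‖v - (y - p)‖²` isolates the inner product; its positivity says that the half-space
strictly separates `y` from the zeros. -/
theorem relative_error_inner_ge {y p v : E} {σ : ℝ}
    (h : ‖v + p - y‖ ^ 2 ≤ σ ^ 2 * (‖p - y‖ ^ 2 + ‖v‖ ^ 2)) :
    (1 - σ ^ 2) / 2 * (‖p - y‖ ^ 2 + ‖v‖ ^ 2) ≤ inner ℝ (y - p) v := by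
  have h1 : v + p - y = v - (y - p) := by abel
  rw [h1, norm_sub_sq_real, norm_sub_rev y p, real_inner_comm] at h
  linarith

/-- The relative error criterion bounds the residuals by the length of the projection step. -/
theorem residuals_le_of_relative_error {y p v : E} {σ θ : ℝ} (hσ : σ ^ 2 ≤ 1) (hv : v ≠ 0)
    (hθ : θ = inner ℝ (y - p) v / ‖v‖ ^ 2)
    (h : ‖v + p - y‖ ^ 2 ≤ σ ^ 2 * (‖p - y‖ ^ 2 + ‖v‖ ^ 2)) :
    ((1 - σ ^ 2) / 2) ^ 2 * (‖p - y‖ ^ 2 + ‖v‖ ^ 2) ≤ ‖θ • v‖ ^ 2 := by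
  have hv2 : 0 < ‖v‖ ^ 2 := by
    have := norm_pos_iff.2 hv
    positivity
  have h1 := relative_error_inner_ge h
  set κ := (1 - σ ^ 2) / 2 with hκ
  have hκ0 : 0 ≤ κ := by rw [hκ]; linarith
  set S := ‖p - y‖ ^ 2 + ‖v‖ ^ 2 with hS
  have hvS : ‖v‖ ^ 2 ≤ S := by rw [hS]; linarith [sq_nonneg ‖p - y‖]
  have hS0 : 0 ≤ S := hv2.le.trans hvS
  have h2 : ‖θ • v‖ ^ 2 = inner ℝ (y - p) v ^ 2 / ‖v‖ ^ 2 := by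
    rw [norm_smul, mul_pow, Real.norm_eq_abs, sq_abs, hθ]
    field_simp
  rw [h2, le_div_iff₀ hv2]
  calc κ ^ 2 * S * ‖v‖ ^ 2 ≤ κ ^ 2 * S * S := mul_le_mul_of_nonneg_left hvS (by positivity)
    _ = (κ * S) ^ 2 := by ring
    _ ≤ _ := pow_le_pow_left₀ (by positivity) h1 2

end Inertia

/-! ### Maximal monotone operators and their resolvents. -/

section Operators

variable {n : ℕ}

/-- The graph of a maximal monotone operator is closed. -/
theorem IsMaximalMonotone.mem_of_tendsto {T : Operator n} (hT : IsMaximalMonotone T)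
    {ι : Type*} {l : Filter ι} [l.NeBot] {x u : ι → Vec n} {x₀ u₀ : Vec n}
    (hx : Tendsto x l (𝓝 x₀)) (hu : Tendsto u l (𝓝 u₀)) (h : ∀ᶠ i in l, u i ∈ T (x i)) :
    u₀ ∈ T x₀ := by
  have hkey : ∀ y : Vec n, ∀ v ∈ T y, 0 ≤ inner ℝ (x₀ - y) (u₀ - v) := fun y v hv =>
    ge_of_tendsto ((hx.sub_const y).inner (hu.sub_const v))
      (h.mono fun i hi => hT.prop _ _ _ hi _ hv)
  -- Adjoining the limit pair to the graph keeps monotonicity, so maximality forces the pair to be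
  -- in `T` already.
  set T' : Operator n := fun y => {v | v ∈ T y ∨ (y = x₀ ∧ v = u₀)} with hT'
  have hmono : IsMonotone T' := by
    rintro y y' v (hv | ⟨rfl, rfl⟩) v' (hv' | ⟨rfl, rfl⟩)
    · exact hT.prop _ _ _ hv _ hv'
    · rw [← neg_sub y', ← neg_sub v', inner_neg_neg]
      exact hkey _ _ hv
    · exact hkey _ _ hv'
    · simp
  have hle : T ≤ T' := fun y v hv => Or.inl hv
  exact hT.le_of_ge hmono hle x₀ (Or.inr ⟨rfl, rfl⟩)

/-- The resolvent of a monotone operator is firmly nonexpansive. -/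
theorem IsMonotone.norm_sq_add_le {T : Operator n} (hT : IsMonotone T) {γ : ℝ} (hγ : 0 ≤ γ)
    {x y u v : Vec n} (hu : u ∈ T x) (hv : v ∈ T y) :
    ‖x - y‖ ^ 2 + ‖γ • (u - v)‖ ^ 2 ≤ ‖(x + γ • u) - (y + γ • v)‖ ^ 2 := by
  have h1 : (x + γ • u) - (y + γ • v) = (x - y) + γ • (u - v) := by module
  rw [h1, norm_add_sq_real, real_inner_smul_right]
  have := mul_nonneg hγ (hT x y u hu v hv)
  linarith

/-- Monotonicity of the Douglas–Rachford splitting operator, tested at one of its zeros. -/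
theorem splitting_inner_nonneg {A B : Operator n} (hA : IsMonotone A) (hB : IsMonotone B)
    {γ : ℝ} (hγ : 0 ≤ γ) {x w r a s b : Vec n} (hwB : w ∈ B x) (hwA : -w ∈ A x) (ha : a ∈ A r)
    (hb : b ∈ B s) (h : r + γ • a = s - γ • b) :
    0 ≤ inner ℝ (s - r) (r + γ • b - (x + γ • w)) := by
  have h1 : s - r = γ • (a + b) := by
    rw [smul_add, ← sub_eq_zero]
    rw [← sub_eq_zero] at h
    rw [← neg_eq_zero, ← h]
    abel
  have h2 : r + γ • b - (x + γ • w) = (r - x) + γ • (b - w) := by module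
  have h3 : s - x = (r - x) + γ • (a + b) := by rw [← h1]; abel
  have h4 := hA r x a ha (-w) hwA
  have h5 := hB s x b hb w hwB
  rw [h3] at h5
  rw [h1, h2]
  -- The product splits into the monotonicity products of `A` at `r, x` and of `B` at `s, x`, since
  -- `s - x = (r - x) + γ(a + b)`.
  have h6 : inner ℝ (γ • (a + b)) ((r - x) + γ • (b - w)) =
      γ * (inner ℝ (r - x) (a - -w) + inner ℝ ((r - x) + γ • (a + b)) (b - w)) := by
    have h7 : a - -w = a + b - (b - w) := by abel
    rw [h7]
    generalize a + b = c
    generalize r - x = e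
    generalize b - w = f
    simp only [inner_add_left, inner_add_right, inner_sub_right, real_inner_smul_left,
      real_inner_smul_right]
    rw [real_inner_comm c e]
    ring
  rw [h6]
  exact mul_nonneg hγ (add_nonneg h4 h5)

/-- The resolvent of `T` maps convergent sequences to convergent sequences. -/
theorem IsMaximalMonotone.exists_tendsto {T : Operator n} (hT : IsMaximalMonotone T)
    {γ : ℝ} (hγ : 0 < γ) {x u : ℕ → Vec n} {z : Vec n} (hu : ∀ k, u k ∈ T (x k))
    (hz : Tendsto (fun k => x k + γ • u k) atTop (𝓝 z)) :
    ∃ x₀ u₀, u₀ ∈ T x₀ ∧ x₀ + γ • u₀ = z ∧ Tendsto x atTop (𝓝 x₀) ∧ Tendsto u atTop (𝓝 u₀) := by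
  have hx : CauchySeq x := by
    refine Metric.cauchySeq_iff.2 fun ε hε => ?_
    obtain ⟨N, hN⟩ := Metric.cauchySeq_iff.1 hz.cauchySeq ε hε
    refine ⟨N, fun k hk m hm => lt_of_le_of_lt ?_ (hN k hk m hm)⟩
    rw [dist_eq_norm, dist_eq_norm]
    refine le_of_sq_le_sq ?_ (norm_nonneg _)
    linarith [hT.prop.norm_sq_add_le hγ.le (hu k) (hu m), sq_nonneg ‖γ • (u k - u m)‖]
  obtain ⟨x₀, hx₀⟩ := cauchySeq_tendsto_of_complete hx
  have hu₀ : Tendsto u atTop (𝓝 (γ⁻¹ • (z - x₀))) := by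
    refine ((hz.sub hx₀).const_smul γ⁻¹).congr fun k => ?_
    rw [add_sub_cancel_left, inv_smul_smul₀ hγ.ne']
  refine ⟨x₀, _, hT.mem_of_tendsto hx₀ hu₀ (Eventually.of_forall hu), ?_, hx₀, hu₀⟩
  rw [smul_inv_smul₀ hγ.ne']
  abel

theorem isSolution_of_mem {A B : Operator n} {x b : Vec n} (hb : b ∈ B x) (ha : -b ∈ A x) :
    IsSolution A B x :=
  ⟨-b, ha, b, hb, by simp⟩

/-- If both residuals of the splitting vanish, then the `A`-parts converge as well, and the limit
is a solution. -/
theorem tendsto_of_resolvent_eq {A : Operator n} (hA : IsMaximalMonotone A) {γ : ℝ} (hγ : 0 < γ)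
    {s b r a : ℕ → Vec n} {x w : Vec n} (hs : Tendsto s atTop (𝓝 x)) (hb : Tendsto b atTop (𝓝 w))
    (hsr : Tendsto (fun k => s k - r k) atTop (𝓝 0))
    (h : ∀ᶠ k in atTop, a k ∈ A (r k) ∧ r k + γ • a k = s k - γ • b k) :
    -w ∈ A x ∧ Tendsto r atTop (𝓝 x) ∧ Tendsto a atTop (𝓝 (-w)) := by
  have hr : Tendsto r atTop (𝓝 x) := by simpa using hs.sub hsr
  have ha : Tendsto a atTop (𝓝 (-w)) := by
    have h1 := (hsr.const_smul γ⁻¹).sub hb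
    rw [smul_zero, zero_sub] at h1
    refine h1.congr' (h.mono fun k hk => ?_)
    have h2 : s k - r k = γ • a k + γ • b k := by
      rw [← sub_eq_zero, ← neg_eq_zero, ← sub_eq_zero.2 hk.2]
      abel
    rw [h2, ← smul_add, inv_smul_smul₀ hγ.ne']
    abel
  exact ⟨hA.mem_of_tendsto hr ha (h.mono fun k hk => hk.1), hr, ha⟩

end Operators

theorem tendsto_zero_of_norm_sq_le {E : Type*} [NormedAddCommGroup E] {f : ℕ → E} {g : ℕ → ℝ}
    (h : ∀ᶠ k in atTop, ‖f k‖ ^ 2 ≤ g k) (hg : Tendsto g atTop (𝓝 0)) :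
    Tendsto f atTop (𝓝 0) := by
  have h1 : Tendsto (fun k => ‖f k‖ ^ 2) atTop (𝓝 0) :=
    squeeze_zero' (Eventually.of_forall fun k => sq_nonneg _) h hg
  have h2 := h1.sqrt
  simp only [Real.sqrt_sq (norm_nonneg _), Real.sqrt_zero] at h2
  exact tendsto_zero_iff_norm_tendsto_zero.2 h2

/-- At `a = β` the gap `μ(1 - a)² - a(1 + a)` vanishes, so it is positive for smaller `a ≥ 0`. The
denominator is `2β² - β + 1`, which has no real root. -/
theorem relaxation_bound {β ρ : ℝ} (hβ1 : β < 1)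
    (hρ : ρ = 2 * (β - 1) ^ 2 / (2 * (β - 1) ^ 2 + 3 * β - 1)) :
    (2 / ρ - 1) * (1 - β) ^ 2 = β * (1 + β) := by
  have h1 : β - 1 ≠ 0 := by linarith
  have h2 : 2 * (β - 1) ^ 2 + 3 * β - 1 ≠ 0 := by nlinarith [sq_nonneg (4 * β - 1)]
  rw [hρ]
  field_simp
  ring

/-! ### Convergence of the algorithm. -/

namespace Trace

variable {n : ℕ} (t : Trace n)

/-- The governing sequence of the underlying inertial proximal-projection method. -/
def gov (γ : ℝ) (k : ℕ) : Vec n := t.r k + γ • t.b k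

theorem rHat_add_smul_bHat (γ : ℝ) (k : ℕ) :
    t.rHat k + γ • t.bHat k =
      t.gov γ k + t.α k • (t.gov γ k - t.gov γ (k - 1)) := by
  simp only [rHat, bHat, extrapolate, gov]
  module

variable {t} {A B : Operator n} {P : Procedure n} {p : Params}

theorem InnerStep.mem_right (hP : IsBProcedure B P) {k ℓ : ℕ} (hℓ : 1 ≤ ℓ)
    (h : t.InnerStep A P p k ℓ) : t.bIn k ℓ ∈ B (t.sIn k ℓ) := by
  have := (hP (t.rHat k) (t.bHat k) p.γ (t.sHat k) (t.bHat k) p.γ_pos).1 ℓ hℓ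
  rwa [← h.1] at this

/-- The reason for the update rule of `b`: it cancels `r (k + 1)` and leaves a step along `s - r`.
-/
theorem Completes.gov_succ {k : ℕ} (h : t.Completes A P p k) :
    t.gov p.γ (k + 1) = t.rHat k + p.γ • t.bHat k -
      (t.ρ k * t.θ (k + 1)) • (t.sIn k (t.last k) - t.rIn k (t.last k)) := by
  obtain ⟨-, -, -, -, hs, hr, -, hb⟩ := h
  rw [gov, hb, smul_sub, smul_inv_smul₀ p.γ_pos.ne', ← hs, ← hr]
  module

theorem Completes.innerStep {k : ℕ} (h : t.Completes A P p k) :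
    t.InnerStep A P p k (t.last k) :=
  h.2.1.2.1 _ h.2.1.1 le_rfl

theorem Completes.theta_eq {k : ℕ} (h : t.Completes A P p k) :
    t.θ (k + 1) = inner ℝ (t.rHat k + p.γ • t.bHat k -
        (t.rIn k (t.last k) + p.γ • t.bIn k (t.last k)))
      (t.sIn k (t.last k) - t.rIn k (t.last k)) /
        ‖t.sIn k (t.last k) - t.rIn k (t.last k)‖ ^ 2 := by
  rw [h.2.2.2.2.2.2.1]
  congr 2
  module

theorem Completes.relative_error {k : ℕ} (h : t.Completes A P p k) :
    ‖(t.sIn k (t.last k) - t.rIn k (t.last k)) +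
        (t.rIn k (t.last k) + p.γ • t.bIn k (t.last k)) - (t.rHat k + p.γ • t.bHat k)‖ ^ 2 ≤
      p.σ ^ 2 * (‖t.rIn k (t.last k) + p.γ • t.bIn k (t.last k) -
        (t.rHat k + p.γ • t.bHat k)‖ ^ 2 + ‖t.sIn k (t.last k) - t.rIn k (t.last k)‖ ^ 2) := by
  have := h.2.1.2.2.2
  rw [Accepted] at this
  convert this using 3
  abel

theorem sigma_sq_lt_one (p : Params) : p.σ ^ 2 < 1 :=
  (sq_lt_one_iff₀ p.σ_nonneg).2 p.σ_lt_one

theorem Completes.theta_nonneg {k : ℕ} (h : t.Completes A P p k) : 0 ≤ t.θ (k + 1) := by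
  rw [h.theta_eq]
  refine div_nonneg (le_trans ?_ (relative_error_inner_ge h.relative_error)) (sq_nonneg _)
  have := sigma_sq_lt_one p
  have : 0 ≤ (1 - p.σ ^ 2) / 2 := by linarith
  positivity

theorem Completes.fejer (hA : IsMaximalMonotone A) (hB : IsMaximalMonotone B)
    (hP : IsBProcedure B P) {k : ℕ} (h : t.Completes A P p k) {x w : Vec n} (hwB : w ∈ B x)
    (hwA : -w ∈ A x) :
    ‖t.gov p.γ (k + 1) - (x + p.γ • w)‖ ^ 2 ≤
      ‖t.gov p.γ k + t.α k • (t.gov p.γ k - t.gov p.γ (k - 1)) - (x + p.γ • w)‖ ^ 2 -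
        (2 / p.ρmax - 1) * ‖t.gov p.γ (k + 1) -
          (t.gov p.γ k + t.α k • (t.gov p.γ k - t.gov p.γ (k - 1)))‖ ^ 2 := by
  rw [← rHat_add_smul_bHat, h.gov_succ]
  have hρ := h.2.2.2.1
  exact norm_relaxed_projection_sub_sq_le (p.ρmin_pos.trans_le hρ.1) hρ.2
    (sub_ne_zero.2 h.2.2.1) h.theta_eq h.theta_nonneg
    (splitting_inner_nonneg hA.prop hB.prop p.γ_pos.le hwB hwA h.innerStep.2.1
      (h.innerStep.mem_right hP h.2.1.1) h.innerStep.2.2)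

/-- The step is `ρ k` times the exact projection step, so the lower bound `ρmin` lets its length
control the residuals. -/
theorem Completes.residuals_le {k : ℕ} (h : t.Completes A P p k) :
    ‖t.rIn k (t.last k) + p.γ • t.bIn k (t.last k) - (t.rHat k + p.γ • t.bHat k)‖ ^ 2 +
        ‖t.sIn k (t.last k) - t.rIn k (t.last k)‖ ^ 2 ≤
      (((1 - p.σ ^ 2) / 2) ^ 2 * p.ρmin ^ 2)⁻¹ *
        ‖t.gov p.γ (k + 1) - (t.rHat k + p.γ • t.bHat k)‖ ^ 2 := by
  have hσ := sigma_sq_lt_one p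
  have hκ : 0 < (1 - p.σ ^ 2) / 2 := by linarith
  have hρ := p.ρmin_pos
  have h1 := residuals_le_of_relative_error hσ.le (sub_ne_zero.2 h.2.2.1) h.theta_eq
    h.relative_error
  rw [inv_mul_eq_div, le_div_iff₀ (by positivity), h.gov_succ, sub_sub_cancel_left, norm_neg,
    mul_smul, norm_smul (t.ρ k), mul_pow, Real.norm_eq_abs, sq_abs]
  have h2 : p.ρmin ^ 2 ≤ t.ρ k ^ 2 := pow_le_pow_left₀ hρ.le h.2.2.2.1.1 2
  have h3 := mul_le_mul h2 h1 (by positivity) (sq_nonneg _)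
  linarith

theorem IsInfiniteRun.tendsto (hA : IsMaximalMonotone A) (hB : IsMaximalMonotone B)
    (hsol : ∃ x : Vec n, IsSolution A B x) (hP : IsBProcedure B P) {β : ℝ} (hβ0 : 0 < β)
    (hαβ : p.α < β) (hβ1 : β < 1)
    (hρ : p.ρmax = 2 * (β - 1) ^ 2 / (2 * (β - 1) ^ 2 + 3 * β - 1))
    (h : t.IsInfiniteRun A P p) (hmono : ∀ k, t.α k ≤ t.α (k + 1)) :
    ∃ x b : Vec n, IsSolution A B x ∧ b ∈ B x ∧ -b ∈ A x ∧
      Tendsto t.s atTop (𝓝 x) ∧ Tendsto t.r atTop (𝓝 x) ∧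
      Tendsto (fun k => t.bIn k (t.last k)) atTop (𝓝 b) ∧
      Tendsto t.b atTop (𝓝 b) ∧
      Tendsto (fun k => t.aIn k (t.last k)) atTop (𝓝 (-b)) := by
  have hγ := p.γ_pos
  set z := t.gov p.γ with hz
  set μ := 2 / p.ρmax - 1 with hμ
  have hβ := relaxation_bound hβ1 hρ
  have hρ0 : 0 < p.ρmax := p.ρmin_pos.trans p.ρmin_lt_ρmax
  have hμ0 : 0 ≤ μ := by
    rw [hμ, sub_nonneg, le_div_iff₀ hρ0]
    linarith [p.ρmax_lt_two]
  -- The uniform slack in the gap condition, positive because `α < β`.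
  have hε : 0 < β * (1 + β) - p.α * (1 + p.α) := by nlinarith [p.α_nonneg]
  have ha0 : ∀ k, 0 ≤ t.α k := fun k => (h k).1.1
  have haα : ∀ k, t.α k ≤ p.α := fun k => (h k).1.2
  have hgap : ∀ k, β * (1 + β) - p.α * (1 + p.α) ≤
      μ * (1 - t.α k) ^ 2 - t.α k * (1 + t.α k) := by
    intro k
    have h1 : (1 - β) ^ 2 ≤ (1 - t.α k) ^ 2 :=
      pow_le_pow_left₀ (by linarith) (by linarith [haα k]) 2
    have h2 := mul_le_mul_of_nonneg_left h1 hμ0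
    nlinarith [ha0 k, haα k]
  have hfejer : ∀ x w : Vec n, w ∈ B x → -w ∈ A x →
      Summable (fun k => ‖z k - z (k - 1)‖ ^ 2) ∧
        ∃ l, Tendsto (fun k => ‖z k - (x + p.γ • w)‖ ^ 2) atTop (𝓝 l) := fun x w hwB hwA =>
    inertial_fejer ha0 haα p.α_lt_one hmono hμ0 hε hgap fun k =>
      (h k).fejer hA hB hP hwB hwA
  obtain ⟨x₁, a₁, ha₁, w₁, hw₁, hsum₁⟩ := hsol
  have haw : a₁ = -w₁ := eq_neg_of_add_eq_zero_left hsum₁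
  subst haw
  obtain ⟨hsum, l₁, hl₁⟩ := hfejer x₁ w₁ hw₁ ha₁
  -- the steps, the extrapolations and the residuals vanish
  have hstep : Tendsto (fun k => z k - z (k - 1)) atTop (𝓝 0) :=
    tendsto_zero_of_norm_sq_le (Eventually.of_forall fun k => le_rfl) hsum.tendsto_atTop_zero
  have hextra : Tendsto (fun k => t.rHat k + p.γ • t.bHat k - z k) atTop (𝓝 0) := by
    have : Tendsto (fun k => ‖z k - z (k - 1)‖) atTop (𝓝 0) := by simpa using hstep.norm
    refine squeeze_zero_norm (fun k => ?_) this
    rw [rHat_add_smul_bHat, add_sub_cancel_left, norm_smul, Real.norm_of_nonneg (ha0 k)]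
    exact mul_le_of_le_one_left (norm_nonneg _) ((haα k).trans p.α_lt_one.le)
  have hproj : Tendsto (fun k => z (k + 1) - (t.rHat k + p.γ • t.bHat k)) atTop (𝓝 0) := by
    have := (hstep.comp (tendsto_add_atTop_nat 1)).sub hextra
    rw [sub_zero] at this
    refine this.congr fun k => ?_
    simp only [Function.comp, Nat.add_sub_cancel]
    abel
  have hproj2 : Tendsto (fun k => (((1 - p.σ ^ 2) / 2) ^ 2 * p.ρmin ^ 2)⁻¹ *
      ‖z (k + 1) - (t.rHat k + p.γ • t.bHat k)‖ ^ 2) atTop (𝓝 0) := by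
    simpa using (hproj.norm.pow 2).const_mul _
  set s' := fun k => t.sIn k (t.last k) with hs'
  set r' := fun k => t.rIn k (t.last k) with hr'
  set b' := fun k => t.bIn k (t.last k) with hb'
  set a' := fun k => t.aIn k (t.last k) with ha'
  have hres : Tendsto (fun k => s' k - r' k) atTop (𝓝 0) :=
    tendsto_zero_of_norm_sq_le (Eventually.of_forall fun k =>
      (le_add_of_nonneg_left (sq_nonneg _)).trans (h k).residuals_le) hproj2
  have hres2 : Tendsto (fun k => r' k + p.γ • b' k - (t.rHat k + p.γ • t.bHat k)) atTop (𝓝 0) :=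
    tendsto_zero_of_norm_sq_le (Eventually.of_forall fun k =>
      (le_add_of_nonneg_right (sq_nonneg _)).trans (h k).residuals_le) hproj2
  have hgovdiff : Tendsto (fun k => s' k + p.γ • b' k - z k) atTop (𝓝 0) := by
    have := (hres.add hres2).add hextra
    rw [add_zero, add_zero] at this
    refine this.congr fun k => ?_
    abel
  have hmemB : ∀ k, b' k ∈ B (s' k) := fun k => (h k).innerStep.mem_right hP (h k).2.1.1
  have hmemA : ∀ k, a' k ∈ A (r' k) ∧ r' k + p.γ • a' k = s' k - p.γ • b' k :=
    fun k => (h k).innerStep.2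
  -- a cluster point of the governing sequence
  obtain ⟨R, hR⟩ := hl₁.bddAbove_range
  have hmemball : ∀ k, z k ∈ Metric.closedBall (x₁ + p.γ • w₁) (Real.sqrt R) := fun k => by
    rw [mem_closedBall_iff_norm]
    exact Real.le_sqrt_of_sq_le (hR ⟨k, rfl⟩)
  obtain ⟨z₀, -, τ, hτ, hzτ⟩ := (isCompact_closedBall _ _).tendsto_subseq hmemball
  have hτ' := hτ.tendsto_atTop
  have hlim : Tendsto (fun k => s' (τ k) + p.γ • b' (τ k)) atTop (𝓝 z₀) := by
    have := (hgovdiff.comp hτ').add hzτ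
    rw [zero_add] at this
    refine this.congr fun k => ?_
    simp
  obtain ⟨x, w, hwB, hxw, hsx, hbw⟩ :=
    hB.exists_tendsto hγ (x := fun k => s' (τ k)) (u := fun k => b' (τ k))
      (fun k => hmemB (τ k)) hlim
  obtain ⟨hwA, -, -⟩ := tendsto_of_resolvent_eq hA hγ (r := fun k => r' (τ k))
    (a := fun k => a' (τ k)) hsx hbw (hres.comp hτ') (Eventually.of_forall fun k => hmemA (τ k))
  -- the whole sequence converges
  obtain ⟨-, l, hl⟩ := hfejer x w hwB hwA
  rw [hxw] at hl
  -- The whole sequence of distances converges, and along `τ` it tends to zero.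
  have hl0 : l = 0 := by
    refine tendsto_nhds_unique (hl.comp hτ') ?_
    simpa [Function.comp_def] using ((hzτ.sub_const z₀).norm).pow 2
  rw [hl0] at hl
  have hz₀ : Tendsto z atTop (𝓝 z₀) :=
    tendsto_sub_nhds_zero_iff.1
      (tendsto_zero_of_norm_sq_le (Eventually.of_forall fun k => le_rfl) hl)
  have hlim' : Tendsto (fun k => s' k + p.γ • b' k) atTop (𝓝 z₀) := by
    simpa using hgovdiff.add hz₀
  -- With `z` convergent, the resolvent of `B` gives limits along the full sequence, identified with
  -- those along `τ`.
  obtain ⟨x', w', -, -, hsx', hbw'⟩ := hB.exists_tendsto hγ hmemB hlim'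
  obtain rfl : x = x' := tendsto_nhds_unique hsx (hsx'.comp hτ')
  obtain rfl : w = w' := tendsto_nhds_unique hbw (hbw'.comp hτ')
  obtain ⟨-, hrx, haw⟩ := tendsto_of_resolvent_eq hA hγ hsx' hbw' hres
    (Eventually.of_forall hmemA)
  have hs : Tendsto t.s atTop (𝓝 x) :=
    (tendsto_add_atTop_iff_nat 1).1 (hsx'.congr fun k => ((h k).2.2.2.2.1).symm)
  have hr : Tendsto t.r atTop (𝓝 x) :=
    (tendsto_add_atTop_iff_nat 1).1 (hrx.congr fun k => ((h k).2.2.2.2.2.1).symm)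
  have hb : Tendsto t.b atTop (𝓝 w) := by
    have h1 := (hz₀.sub hr).const_smul p.γ⁻¹
    rw [← hxw, add_sub_cancel_left, inv_smul_smul₀ hγ.ne'] at h1
    refine h1.congr fun k => ?_
    rw [hz, gov, add_sub_cancel_left, inv_smul_smul₀ hγ.ne']
  exact ⟨x, w, isSolution_of_mem hwB hwA, hwB, hwA, hs, hr, hbw', hb, haw⟩

theorem InnerLoopRunsForever.tendsto (hA : IsMaximalMonotone A) (hB : IsMaximalMonotone B)
    (hP : IsBProcedure B P) {K : ℕ} (hσ : 0 < p.σ) (h : t.InnerLoopRunsForever A P p K) :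
    ∃ x b : Vec n, IsSolution A B x ∧ b ∈ B x ∧ -b ∈ A x ∧
      Tendsto (fun ℓ => t.sIn K ℓ) atTop (𝓝 x) ∧ Tendsto (fun ℓ => t.rIn K ℓ) atTop (𝓝 x) ∧
      Tendsto (fun ℓ => t.bIn K ℓ) atTop (𝓝 b) ∧ Tendsto (fun ℓ => t.aIn K ℓ) atTop (𝓝 (-b)) := by
  obtain ⟨-, ⟨⟨x, w⟩, hxw⟩, hres⟩ :=
    hP (t.rHat K) (t.bHat K) p.γ (t.sHat K) (t.bHat K) p.γ_pos
  have heq : ∀ᶠ ℓ in atTop, P (t.rHat K) (t.bHat K) p.γ (t.sHat K) (t.bHat K) ℓ =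
      (t.sIn K ℓ, t.bIn K ℓ) :=
    (eventually_ge_atTop 1).mono fun ℓ hℓ => (h ℓ hℓ).1.1.symm
  have hsb := hxw.congr' heq
  have hs : Tendsto (fun ℓ => t.sIn K ℓ) atTop (𝓝 x) := (continuous_fst.tendsto _).comp hsb
  have hb : Tendsto (fun ℓ => t.bIn K ℓ) atTop (𝓝 w) := (continuous_snd.tendsto _).comp hsb
  have hz : Tendsto (fun ℓ => t.sIn K ℓ + p.γ • t.bIn K ℓ) atTop
      (𝓝 (t.rHat K + p.γ • t.bHat K)) :=
    hres.congr' (heq.mono fun ℓ hℓ => by rw [hℓ])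
  have hzero : Tendsto (fun ℓ => (p.σ ^ 2)⁻¹ * ‖t.sIn K ℓ + p.γ • t.bIn K ℓ -
      (t.rHat K + p.γ • t.bHat K)‖ ^ 2) atTop (𝓝 0) := by
    simpa using (((hz.sub_const (t.rHat K + p.γ • t.bHat K)).norm).pow 2).const_mul (p.σ ^ 2)⁻¹
  have hsr : Tendsto (fun ℓ => t.sIn K ℓ - t.rIn K ℓ) atTop (𝓝 0) := by
    refine tendsto_zero_of_norm_sq_le ((eventually_ge_atTop 1).mono fun ℓ hℓ => ?_) hzero
    have h1 := (h ℓ hℓ).2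
    rw [Accepted, not_le] at h1
    -- The rejected criterion, divided by `σ² > 0`, bounds `‖s - r‖²` by the vanishing error.
    rw [inv_mul_eq_div, le_div_iff₀ (by positivity), mul_comm]
    refine le_trans (mul_le_mul_of_nonneg_left ?_ (sq_nonneg _)) h1.le
    exact le_add_of_nonneg_left (sq_nonneg _)
  have hwB : w ∈ B x := hB.mem_of_tendsto hs hb
    ((eventually_ge_atTop 1).mono fun ℓ hℓ => (h ℓ hℓ).1.mem_right hP hℓ)
  obtain ⟨hwA, hr, ha⟩ := tendsto_of_resolvent_eq hA p.γ_pos hs hb hsr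
    ((eventually_ge_atTop 1).mono fun ℓ hℓ => (h ℓ hℓ).1.2)
  exact ⟨x, w, isSolution_of_mem hwB hwA, hwB, hwA, hs, hr, hb, ha⟩

theorem IsRunStoppedAt.isSolution (hP : IsBProcedure B P) {K : ℕ} (h : t.IsRunStoppedAt A P p K) :
    IsSolution A B (t.sIn K (t.last K)) := by
  obtain ⟨-, -, hterm, heq⟩ := h
  have hstep := hterm.2.1 _ hterm.1 le_rfl
  refine isSolution_of_mem (hstep.mem_right hP hterm.1) ?_
  obtain ⟨-, ha, hra⟩ := hstep
  rw [heq, sub_eq_add_neg, ← smul_neg] at hra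
  rw [← smul_right_injective _ p.γ_pos.ne' (add_left_cancel hra), heq]
  exact ha

end Trace

end InertialDR

theorem theorem3p3 (n : ℕ) (A B : InertialDR.Operator n)
    (hA : InertialDR.IsMaximalMonotone A) (hB : InertialDR.IsMaximalMonotone B)
    (hsol : ∃ x : InertialDR.Vec n, InertialDR.IsSolution A B x)
    (P : InertialDR.Procedure n) (hP : InertialDR.IsBProcedure B P)
    (p : InertialDR.Params) (β : ℝ) (hβ0 : 0 < β) (hαβ : p.α < β) (hβ1 : β < 1)
    (hρ : p.ρmax = 2 * (β - 1) ^ 2 / (2 * (β - 1) ^ 2 + 3 * β - 1))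
    (t : InertialDR.Trace n) :
    -- (a) infinitely many outer iterations
    (t.IsInfiniteRun A P p → (∀ k : ℕ, t.α k ≤ t.α (k + 1)) →
      ∃ x b : InertialDR.Vec n, InertialDR.IsSolution A B x ∧ b ∈ B x ∧ -b ∈ A x ∧
        Tendsto t.s atTop (𝓝 x) ∧
        Tendsto t.r atTop (𝓝 x) ∧
        Tendsto (fun k => t.bIn k (t.last k)) atTop (𝓝 b) ∧
        Tendsto t.b atTop (𝓝 b) ∧
        Tendsto (fun k => t.aIn k (t.last k)) atTop (𝓝 (-b))) ∧
    -- (b) the inner loop of outer iteration `K` runs forever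
    (∀ K : ℕ, 0 < p.σ → t.IsRunStuckAt A P p K → (∀ k : ℕ, k < K → t.α k ≤ t.α (k + 1)) →
      ∃ x b : InertialDR.Vec n, InertialDR.IsSolution A B x ∧ b ∈ B x ∧ -b ∈ A x ∧
        Tendsto (fun ℓ => t.sIn K ℓ) atTop (𝓝 x) ∧
        Tendsto (fun ℓ => t.rIn K ℓ) atTop (𝓝 x) ∧
        Tendsto (fun ℓ => t.bIn K ℓ) atTop (𝓝 b) ∧
        Tendsto (fun ℓ => t.aIn K ℓ) atTop (𝓝 (-b))) ∧
    -- (c) the algorithm stops in outer iteration `K`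
    (∀ K : ℕ, t.IsRunStoppedAt A P p K → (∀ k : ℕ, k < K → t.α k ≤ t.α (k + 1)) →
      InertialDR.IsSolution A B (t.sIn K (t.last K)) ∧
      InertialDR.IsSolution A B (t.rIn K (t.last K))) := by
  refine ⟨fun h hmono => h.tendsto hA hB hsol hP hβ0 hαβ hβ1 hρ hmono,
    fun K hσ h _ => h.2.2.tendsto hA hB hP hσ, fun K h _ => ⟨h.isSolution hP, ?_⟩⟩
  rw [← h.2.2.2]
  exact h.isSolution hP
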